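/- Throughout, a deterministic finite automaton $\mathbf A$ over an alphabet $\Sigma$ has a finite set of states, an initial state, a set of accepting states and a transition function $(\mathbf p,\sigma)\mapsto \mathbf p\sigma$ that may be partial. It is reduced if every state is reachable from the initial state, distinct states accept distinct languages, and, when some transition is undefined, every state accepts at least one word (so that no state is equivalent to the implicit sink). Its transition semigroup $S$ is the semigroup of partial transformations of the state set induced by the nonempty words. For a positive integer $k$ and words $u,v\in\Sigma^+$ write $u\equiv_k v$ if $u$ and $v$ have the same prefix of length $k-1$, the same suffix of length $k-1$ (a word shorter than $k-1$ being its own prefix and suffix) and the same set of factors of length $k$. A language $L$ is $k$-testable if $u\equiv_k v$ implies $u\in L\Leftrightarrow v\in L$ for all $u,v\in\Sigma^+$. A semigroup $S$ is $k$-testable if there are an alphabet $\Sigma$ and a surjective morphism $\phi:\Sigma^+\to S$ such that $u\equiv_k v$ implies $u\phi=v\phi$ for all $u,v\in\Sigma^+$. An automaton is $k$-testable if the language that it accepts is $k$-testable; it is locally testable if it is $k$-testable for some positive $k$, and the least such $k$ is its order of local testability. For states write $\mathbf p\succ\mathbf q$ if $\mathbf p\ne\mathbf q$ and $\mathbf q$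 is reachable from $\mathbf p$. The 2-tuple graph $\Gamma\Gamma$ of $\mathbf A$ is the directed graph whose nodes are the pairs $(\mathbf p,\mathbf q)$ with $\mathbf p\succ\mathbf q$, with an edge from $(\mathbf p,\mathbf q)$ to $(\mathbf r,\mathbf t)$ if $\mathbf p\sigma=\mathbf r$ and $\mathbf q\sigma=\mathbf t$ for some $\sigma\in\Sigma$. A path is simple if its nodes are pairwise distinct, and its length is its number of edges. **Theorem 3.9.** Let $\mathbf A$ be a reduced deterministic finite locally testable automaton, $S$ its transition semigroup, $\Gamma\Gamma$ its 2-tuple graph, and $k$ a positive integer. If $\Gamma\Gamma$ contains no simple path of length $k-1$, then both the automaton $\mathbf A$ and the semigroup $S$ are $k$-testable. In particular, $k$ is an upper bound on the order of local testability of $\mathbf A$. -/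

import Mathlib

/-- Two words agree in their prefixes and suffixes of length `k - 1` (a shorter word is its own
prefix and suffix) and have the same factors of length `k`. -/
def SameProfile {α : Type*} (k : ℕ) (u v : List α) : Prop :=
  u.take (k - 1) = v.take (k - 1) ∧
  u.drop (u.length - (k - 1)) = v.drop (v.length - (k - 1)) ∧
  {f : List α | f.length = k ∧ f <:+: u} = {f : List α | f.length = k ∧ f <:+: v}

/-- `k`-testability of a language; only nonempty words matter. -/
def IsTestableLanguage {α : Type*} (k : ℕ) (L : Language α) : Prop :=
  ∀ u v : List α, u ≠ [] → v ≠ [] → SameProfile k u v → (u ∈ L ↔ v ∈ L)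

/-- The word, as a list of letters, of an element of the free semigroup. -/
def FreeSemigroup.letters {α : Type*} (w : FreeSemigroup α) : List α :=
  w.head :: w.tail

/-- `k`-testability of a semigroup. -/
def IsTestableSemigroup.{u} (k : ℕ) (S : Type u) [Semigroup S] : Prop :=
  ∃ (α : Type u) (φ : FreeSemigroup α →ₙ* S), Function.Surjective φ ∧
    ∀ u v : FreeSemigroup α, SameProfile k u.letters v.letters → φ u = φ v

/-- Partial transformations of `σ`; `none` means undefined. -/
def PartialTransformation (σ : Type*) := σ → Option σ

/-- Transformations act on the right: in `f * g`, first `f` is applied, then `g`. -/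
instance PartialTransformation.instSemigroup (σ : Type*) :
    Semigroup (PartialTransformation σ) where
  mul f g := fun q => (f q).bind g
  mul_assoc f g h := by
    funext q
    exact Option.bind_assoc (f q) g h

/-- Deterministic automata whose transition function may be partial. A complete automaton is one
whose `step` never takes the value `none`. -/
structure PartialDFA (α σ : Type*) where
  step : σ → α → Option σ
  start : σ
  accept : Set σ

namespace PartialDFA

/-- The state `p w` reached from `p` by reading `w`, if it exists. -/
def run {α σ : Type*} (A : PartialDFA α σ) (p : σ) : List α → Option σ
  | [] => some p
  | a :: w => (A.step p a).bind fun q => A.run q w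

/-- The language of the words accepted from the state `p`. -/
def acceptsFrom {α σ : Type*} (A : PartialDFA α σ) (p : σ) : Language α :=
  {w | ∃ q ∈ A.accept, A.run p w = some q}

/-- The language accepted by the automaton. -/
def accepts {α σ : Type*} (A : PartialDFA α σ) : Language α :=
  A.acceptsFrom A.start

/-- Reduced automata: every state is reachable from the initial one, and no two states are
equivalent. The last clause treats "undefined" as an implicit sink: if some transition is
undefined, no state is equivalent to that sink. A complete automaton may have a sink state. -/
structure IsReduced {α σ : Type*} (A : PartialDFA α σ) : Prop where
  reachable : ∀ q, ∃ w, A.run A.start w = some q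
  distinguishable : ∀ p q, A.acceptsFrom p = A.acceptsFrom q → p = q
  alive : (∃ p a, A.step p a = none) → ∀ q, ∃ w, w ∈ A.acceptsFrom q

/-- The automaton accepts a `k`-testable language. -/
def IsTestable {α σ : Type*} (A : PartialDFA α σ) (k : ℕ) : Prop :=
  IsTestableLanguage k A.accepts

/-- The automaton is `k`-testable for some positive `k`. -/
def IsLocallyTestable {α σ : Type*} (A : PartialDFA α σ) : Prop :=
  ∃ k : ℕ, 0 < k ∧ A.IsTestable k

/-- The order of local testability of a locally testable automaton. -/
noncomputable def testabilityOrder {α σ : Type*} (A : PartialDFA α σ) : ℕ :=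
  sInf {k : ℕ | 0 < k ∧ A.IsTestable k}

/-- The semigroup of partial transformations induced by the nonempty words. -/
def transitionSemigroup {α σ : Type*} (A : PartialDFA α σ) :
    Subsemigroup (PartialTransformation σ) :=
  Subsemigroup.closure (Set.range fun (a : α) (q : σ) => A.step q a)

/-- The relation `p ≻ q`: `q` is reachable from `p` and distinct from it. -/
def Above {α σ : Type*} (A : PartialDFA α σ) (p q : σ) : Prop :=
  (∃ w : List α, A.run p w = some q) ∧ p ≠ q

/-- The 2-tuple graph: its nodes are the pairs `(p, q)` with `p ≻ q`, and each letter defined at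
both components gives an edge, provided that the pair of images is a node. -/
def twoTupleGraph {α σ : Type*} (A : PartialDFA α σ) :
    Digraph {x : σ × σ // A.Above x.1 x.2} where
  Adj x y := ∃ a : α, A.step x.1.1 a = some y.1.1 ∧ A.step x.1.2 a = some y.1.2

end PartialDFA

/-- The digraph has a path with `n` edges and pairwise distinct nodes. -/
def Digraph.HasSimplePath {V : Type*} (G : Digraph V) (n : ℕ) : Prop :=
  ∃ x : Fin (n + 1) → V, Function.Injective x ∧ ∀ i : Fin n, G.Adj (x i.castSucc) (x i.succ)

/-! A word of length at least `k` is a walk in the graph whose nodes are the words of length `k - 1`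
and whose edges are the words of length `k`: its prefix is the start, its suffix the end, its
factors the edges used. By a combinatorial argument in the style of Simon
(`foldl_eq_of_walkEdges_eq`), start, end and edge set determine the action of a walk as soon as the
loops at each node `x` act on the states `s x` as commuting idempotents. A loop at `x` is a word `w`
with `x w = w' x`.

Local testability, of any order `m`, provides the identities `e y e y e = e y e` and `e y e z e = e
z e y e` for long `e`. Applied to a power of a nonempty word fixing two states, they show that such
states coincide if each reaches the other (`eq_of_reaches`), and that if `f` reaches `F`, a word
leads from `f` to a state above `F` exactly when it does so from `F` (`reaches_iff`).

The bound on simple paths produces such words: a pair that stays a node of the 2-tuple graph while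
reading `x`, of length `k - 1`, must run through a cycle, whose label fixes both components
(`exists_cycle`). Idempotence follows by tracking a state under the periodic word `w' w' w' ...`, of
which `x` is a prefix (`trajectory_eq`); commutation follows by showing that the two products lie in
one strongly connected component, where `x` acts as a constant (`act_eq_of_reaches`). -/

/-! ### Walks in a graph whose loops act as a semilattice -/

/-- The labelled edges traversed by the walk reading `u` from the node `x` in the deterministic
graph with transition function `nxt`. -/
def walkEdges {V α : Type*} (nxt : V → α → V) (x : V) (u : List α) : Set (V × α) :=
  {e | ∃ u₁ u₂, u = u₁ ++ e.2 :: u₂ ∧ u₁.foldl nxt x = e.1}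

lemma walkEdges_nil {V α : Type*} (nxt : V → α → V) (x : V) : walkEdges nxt x [] = ∅ := by
  ext e
  simp [walkEdges]

lemma walkEdges_append {V α : Type*} (nxt : V → α → V) (x : V) (u v : List α) :
    walkEdges nxt x (u ++ v) = walkEdges nxt x u ∪ walkEdges nxt (u.foldl nxt x) v := by
  ext ⟨y, a⟩
  simp only [walkEdges, Set.mem_ofPred_eq, Set.mem_union]
  constructor
  · rintro ⟨u₁, u₂, h, rfl⟩
    rcases List.append_eq_append_iff.1 h with ⟨c, rfl, hc⟩ | ⟨c, rfl, hc⟩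
    · exact Or.inr ⟨c, u₂, hc, by simp⟩
    · cases c with
      | nil => exact Or.inr ⟨[], u₂, by simpa using hc.symm, by simp⟩
      | cons b c =>
        obtain ⟨rfl, rfl⟩ := List.cons.inj (by simpa using hc)
        exact Or.inl ⟨u₁, c, rfl, rfl⟩
  · rintro (⟨u₁, u₂, rfl, rfl⟩ | ⟨u₁, u₂, rfl, rfl⟩)
    · exact ⟨u₁, u₂ ++ v, by simp, rfl⟩
    · exact ⟨u ++ u₁, u₂, by simp, by simp⟩

lemma walkEdges_cons {V α : Type*} (nxt : V → α → V) (x : V) (a : α) (u : List α) :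
    walkEdges nxt x (a :: u) = insert (x, a) (walkEdges nxt (nxt x a) u) := by
  have h : walkEdges nxt x [a] = {(x, a)} := by
    ext ⟨y, b⟩
    simp only [walkEdges, Set.mem_ofPred_eq, Set.mem_singleton_iff, Prod.mk.injEq]
    constructor
    · rintro ⟨u₁, u₂, h, rfl⟩
      cases u₁ with
      | nil => exact ⟨rfl, (List.cons.inj h).1.symm⟩
      | cons c u₁ => simp at h
    · rintro ⟨rfl, rfl⟩
      exact ⟨[], [], rfl, rfl⟩
  have := walkEdges_append nxt x [a] u
  rw [h] at this
  rwa [List.singleton_append, ← Set.insert_eq] at this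

/-- A deterministic graph `nxt` and an action `act` of its letters, linked by an invariant, such
that the loops at each node act on the related states as a semilattice. -/
structure LoopsActAsSemilattice {V α Q : Type*} (nxt : V → α → V) (act : Q → α → Q)
    (Inv : V → Q → Prop) : Prop where
  step : ∀ x q a, Inv x q → Inv (nxt x a) (act q a)
  idem : ∀ x q (z : List α), Inv x q → z.foldl nxt x = x →
    z.foldl act (z.foldl act q) = z.foldl act q
  comm : ∀ x q (y z : List α), Inv x q → y.foldl nxt x = x → z.foldl nxt x = x →
    z.foldl act (y.foldl act q) = y.foldl act (z.foldl act q)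

namespace LoopsActAsSemilattice

variable {V α Q : Type*} {nxt : V → α → V} {act : Q → α → Q} {Inv : V → Q → Prop}

lemma foldl_inv (h : LoopsActAsSemilattice nxt act Inv) {x : V} {q : Q} (hq : Inv x q)
    (u : List α) : Inv (u.foldl nxt x) (u.foldl act q) := by
  induction u generalizing x q with
  | nil => exact hq
  | cons a u ih => exact ih (h.step x q a hq)

/-- Edges already used by `u` can be undone: the last letter `a` of `z` occurs in `u = u₁ a u₂`, and
rereading `u₂ z` completes a second turn of the loop `a u₂ z` at the end of `u₁`, which is
idempotent. -/
lemma exists_return (h : LoopsActAsSemilattice nxt act Inv) {x : V} {q : Q} (hq : Inv x q)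
    (u z : List α) (hz : walkEdges nxt (u.foldl nxt x) z ⊆ walkEdges nxt x u) :
    ∃ z', walkEdges nxt ((u ++ z).foldl nxt x) z' ⊆ walkEdges nxt x u ∧
      (u ++ z ++ z').foldl nxt x = u.foldl nxt x ∧
      (u ++ z ++ z').foldl act q = u.foldl act q := by
  induction z using List.reverseRecOn with
  | nil => exact ⟨[], by simp [walkEdges_nil], by simp, by simp⟩
  | append_singleton z a ih =>
    rw [walkEdges_append, Set.union_subset_iff] at hz
    obtain ⟨z', hz'₁, hz'₂, hz'₃⟩ := ih hz.1
    have ha := hz.2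
    rw [walkEdges_cons, Set.insert_subset_iff] at ha
    obtain ⟨u₁, u₂, hu, hy⟩ := ha.1
    simp only at hu hy
    have hu' : u.foldl nxt x = u₂.foldl nxt (nxt (z.foldl nxt (u.foldl nxt x)) a) := by
      conv_lhs => rw [hu]
      simp [hy]
    have hidem := h.idem _ _ (a :: u₂ ++ z) (h.foldl_inv hq u₁) (by
      simp only [List.foldl_append, List.foldl_cons, hy]
      rw [← hu'])
    have huq : u.foldl act q = (a :: u₂).foldl act (u₁.foldl act q) := by
      conv_lhs => rw [hu]
      simp
    refine ⟨u₂ ++ z ++ z', ?_, ?_, ?_⟩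
    · have h2 : walkEdges nxt ((u₁ ++ [a]).foldl nxt x) u₂ ⊆ walkEdges nxt x u := by
        conv_rhs => rw [hu, List.append_cons, walkEdges_append]
        exact Set.subset_union_right
      simp only [List.foldl_append, List.foldl_cons, List.foldl_nil, hy] at h2 ⊢
      simp only [walkEdges_append, List.foldl_append]
      rw [← hu']
      simp only [List.foldl_append] at hz'₁
      exact Set.union_subset (Set.union_subset h2 hz.1) hz'₁
    · simp only [List.foldl_append, List.foldl_cons, List.foldl_nil] at hz'₂ ⊢
      rw [← hu', hz'₂]
    · simp only [List.foldl_append, List.foldl_cons, List.foldl_nil] at hz'₃ hidem huq ⊢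
      rw [← huq] at hidem
      rw [hidem, hz'₃]

/-- By `exists_return` some loop `z'` undoes `z`. Among commuting idempotents, `q z z' = q` forces
`q z = q`. -/
lemma foldl_loop_of_subset (h : LoopsActAsSemilattice nxt act Inv) {x : V} {q : Q}
    (hq : Inv x q) (u z : List α) (hl : z.foldl nxt (u.foldl nxt x) = u.foldl nxt x)
    (hz : walkEdges nxt (u.foldl nxt x) z ⊆ walkEdges nxt x u) :
    z.foldl act (u.foldl act q) = u.foldl act q := by
  obtain ⟨z', -, h₂, h₃⟩ := h.exists_return hq u z hz
  simp only [List.foldl_append, hl] at h₂ h₃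
  have hu := h.foldl_inv hq u
  have hcomm := h.comm _ _ z z' hu hl h₂
  have hidem := h.idem _ _ z hu hl
  calc z.foldl act (u.foldl act q) = z.foldl act (z'.foldl act (z.foldl act (u.foldl act q))) := by
        rw [h₃]
    _ = z.foldl act (z.foldl act (z'.foldl act (u.foldl act q))) := by rw [hcomm]
    _ = z.foldl act (z'.foldl act (u.foldl act q)) :=
        h.idem _ _ z (by simpa [h₂] using h.foldl_inv hu z') hl
    _ = z'.foldl act (z.foldl act (u.foldl act q)) := hcomm.symm
    _ = u.foldl act q := h₃

lemma foldl_insert_loop (h : LoopsActAsSemilattice nxt act Inv) {x d : V} {q : Q}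
    (hq : Inv x q) (u₂ z : List α) (hl : z.foldl nxt d = d) (u₁ : List α)
    (hd : u₁.foldl nxt x = d) (hz : walkEdges nxt d z ⊆ walkEdges nxt x (u₁ ++ u₂)) :
    (u₁ ++ z ++ u₂).foldl act q = (u₁ ++ u₂).foldl act q := by
  -- The induction shortens the part `z₁` of the loop not yet known to use edges of `u₁` only; `u₁`
  -- must vary, since it is lengthened to acquire the missing edges.
  suffices H : ∀ z₁ z₂ u₁, z = z₁ ++ z₂ → u₁.foldl nxt x = d →
      walkEdges nxt d z ⊆ walkEdges nxt x (u₁ ++ u₂) →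
      walkEdges nxt (z₁.foldl nxt d) z₂ ⊆ walkEdges nxt x u₁ →
      (u₁ ++ z ++ u₂).foldl act q = (u₁ ++ u₂).foldl act q from
    H z [] u₁ (by simp) hd hz (by simp [walkEdges_nil])
  intro z₁
  induction z₁ using List.reverseRecOn with
  | nil =>
    rintro z₂ u₁ rfl hd - hz₂
    simp only [List.foldl_append, List.foldl_nil] at *
    rw [h.foldl_loop_of_subset hq u₁ _ (by rw [hd, hl]) (by rwa [hd])]
  | append_singleton z₁ g ih =>
    intro z₂ u₁ hzz hd hz hz₂
    have hg : (z₁.foldl nxt d, g) ∈ walkEdges nxt x u₁ ∪ walkEdges nxt d u₂ := by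
      have := hz (show (z₁.foldl nxt d, g) ∈ walkEdges nxt d z from ⟨z₁, z₂, by simp [hzz], rfl⟩)
      rwa [walkEdges_append, hd] at this
    simp only [List.foldl_append, List.foldl_cons, List.foldl_nil] at hz₂
    rcases hg with hg | hg
    · refine ih (g :: z₂) u₁ (by simp [hzz]) hd hz ?_
      rw [walkEdges_cons]
      exact Set.insert_subset hg hz₂
    · obtain ⟨γ, δ, hu₂, hγ⟩ := hg
      simp only at hu₂ hγ
      -- The target of `g` was already visited by `u₁`: it is `d`, or the source of the first edge
      -- of `z₂`. Hence `γ g v₂` is a loop at `d` that brings `g` into the past.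
      obtain ⟨v₁, v₂, hv, hv₁⟩ :
          ∃ v₁ v₂, u₁ = v₁ ++ v₂ ∧ v₁.foldl nxt x = nxt (z₁.foldl nxt d) g := by
        cases z₂ with
        | nil => exact ⟨u₁, [], by simp, by
            rw [hd]
            conv_lhs => rw [← hl, hzz]
            simp⟩
        | cons b z₂ =>
          rw [walkEdges_cons, Set.insert_subset_iff] at hz₂
          obtain ⟨v₁, v₂, hv, hv₁⟩ := hz₂.1
          exact ⟨v₁, b :: v₂, hv, hv₁⟩
      have hv₂ : v₂.foldl nxt (nxt (z₁.foldl nxt d) g) = d := by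
        rw [← hv₁, ← List.foldl_append, ← hv, hd]
      have hidem := h.idem _ _ (v₂ ++ γ ++ [g]) (h.foldl_inv hq v₁) (by
        simp only [List.foldl_append, List.foldl_cons, List.foldl_nil, hv₁, hv₂, hγ])
      have key : ∀ y, (u₁ ++ (γ ++ g :: v₂) ++ (γ ++ g :: y)).foldl act q =
          (u₁ ++ (γ ++ g :: y)).foldl act q := by
        intro y
        simp only [hv, List.foldl_append, List.foldl_cons, List.foldl_nil] at hidem ⊢
        rw [hidem]
      have hu₁ : (u₁ ++ (γ ++ g :: v₂)).foldl nxt x = d := by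
        simp only [List.foldl_append, List.foldl_cons, hd, hγ, hv₂]
      have hsub : walkEdges nxt x u₁ ⊆ walkEdges nxt x (u₁ ++ (γ ++ g :: v₂)) := by
        rw [walkEdges_append]
        exact Set.subset_union_left
      have := ih (g :: z₂) (u₁ ++ (γ ++ g :: v₂)) (by simp [hzz]) hu₁
        (hz.trans (by
          rw [walkEdges_append, walkEdges_append, hu₁, hd]
          exact Set.union_subset_union_left _ hsub))
        (by
          rw [walkEdges_cons]
          refine Set.insert_subset ?_ (hz₂.trans hsub)
          exact ⟨u₁ ++ γ, v₂, by simp, by simp [hd, hγ]⟩)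
      -- The extra loop `γ g v₂` commutes past `z`; before `u₂ = γ g δ` it amounts to one more turn
      -- of `v₂ γ g`, whose edges are all old by then.
      have hz' : (u₁ ++ z ++ u₂).foldl act q =
          (u₁ ++ (γ ++ g :: v₂) ++ z ++ u₂).foldl act q := by
        have hc := h.comm d _ (γ ++ g :: v₂) z (hd ▸ h.foldl_inv hq u₁)
          (by simp [hγ, hv₂]) hl
        have hb := h.foldl_loop_of_subset hq (u₁ ++ z ++ (γ ++ [g])) (v₂ ++ γ ++ [g])
          (by simp [hd, hl, hγ, hv₂]) (by
            simp only [walkEdges_append, List.foldl_append, List.foldl_cons, List.foldl_nil, hd,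
              hl, hγ, hv₂]
            refine Set.union_subset (Set.union_subset ?_ ?_) ?_
            · intro e he
              left; left
              rw [hv, walkEdges_append, hv₁]
              exact Or.inr he
            · exact fun e he => Or.inr (Or.inl he)
            · exact fun e he => Or.inr (Or.inr he))
        simp only [hu₂, List.foldl_append, List.foldl_cons, List.foldl_nil] at hb hc ⊢
        rw [hc, hb]
      rw [hz', this, hu₂, key δ]

theorem foldl_eq_of_walkEdges_eq (h : LoopsActAsSemilattice nxt act Inv) {x : V} {q : Q}
    (hq : Inv x q) (u v : List α) (hend : u.foldl nxt x = v.foldl nxt x)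
    (hedges : walkEdges nxt x u = walkEdges nxt x v) : u.foldl act q = v.foldl act q := by
  -- Transform `u` into `v` one letter at a time, keeping endpoint, action and edge set. At the end
  -- only a loop `s` with old edges remains after `v`.
  suffices H : ∀ v₁ v₂, v = v₁ ++ v₂ → ∃ s, (v₁ ++ s).foldl nxt x = u.foldl nxt x ∧
      (v₁ ++ s).foldl act q = u.foldl act q ∧ walkEdges nxt x (v₁ ++ s) = walkEdges nxt x v by
    obtain ⟨s, h₁, h₂, h₃⟩ := H v [] (by simp)
    rw [← h₂, List.foldl_append]
    refine h.foldl_loop_of_subset hq v s (by rw [← List.foldl_append, h₁, hend]) ?_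
    rw [walkEdges_append] at h₃
    exact h₃ ▸ Set.subset_union_right
  intro v₁
  induction v₁ using List.reverseRecOn with
  | nil => exact fun _ _ => ⟨u, rfl, rfl, hedges⟩
  | append_singleton v₁ e ih =>
    intro v₂ hv
    obtain ⟨s, h₁, h₂, h₃⟩ := ih (e :: v₂) (by simp [hv])
    by_cases hret : ∃ r, r.foldl nxt (nxt (v₁.foldl nxt x) e) = v₁.foldl nxt x ∧
        walkEdges nxt (nxt (v₁.foldl nxt x) e) r ⊆ walkEdges nxt x v
    · obtain ⟨r, hr₁, hr₂⟩ := hret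
      have hsub : walkEdges nxt (v₁.foldl nxt x) (e :: r) ⊆ walkEdges nxt x v := by
        rw [walkEdges_cons]
        exact Set.insert_subset ⟨v₁, v₂, by simp [hv], rfl⟩ hr₂
      have := h.foldl_insert_loop hq s (e :: r) (by simp [hr₁]) v₁ rfl (h₃ ▸ hsub)
      refine ⟨r ++ s, ?_, ?_, ?_⟩
      · rw [← h₁]
        simp [hr₁]
      · rw [← h₂, ← this]
        simp
      · rw [show v₁ ++ [e] ++ (r ++ s) = v₁ ++ ((e :: r) ++ s) by simp, walkEdges_append,
          walkEdges_append nxt _ (e :: r), List.foldl_cons, hr₁]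
        rw [walkEdges_append] at h₃
        rw [← h₃] at hsub ⊢
        apply Set.Subset.antisymm
        · exact Set.union_subset Set.subset_union_left
            (Set.union_subset hsub Set.subset_union_right)
        · exact Set.union_subset_union_right _ Set.subset_union_right
    -- If `e` lies on no cycle of edges of `v`, it cannot occur in `v₁`, so `s = s₁ e s₂` with `s₁`
    -- a loop. An edge of `s₁` that is `e` or comes after it in `v` would close a cycle through `e`;
    -- hence `s₁` uses only edges of `v₁` and can be dropped.
    · have hv' : walkEdges nxt x v = walkEdges nxt x v₁ ∪
          insert (v₁.foldl nxt x, e) (walkEdges nxt (nxt (v₁.foldl nxt x) e) v₂) := by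
        rw [hv, List.append_assoc, List.singleton_append, walkEdges_append, walkEdges_cons]
      have he : (v₁.foldl nxt x, e) ∈ walkEdges nxt x (v₁ ++ s) := by
        rw [h₃, hv']
        exact Or.inr (Set.mem_insert _ _)
      rw [walkEdges_append] at he
      rcases he with ⟨a, b, hab, ha⟩ | ⟨s₁, s₂, hs, hs₁⟩
      · simp only at hab ha
        refine absurd ⟨b, ?_, ?_⟩ hret
        · conv_rhs => rw [hab]
          simp [ha]
        · rw [hv']
          conv_rhs => rw [hab, walkEdges_append, walkEdges_cons, ha]
          exact fun y hy => Or.inl (Or.inr (Or.inr hy))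
      · simp only at hs hs₁
        rw [walkEdges_append, hs, walkEdges_append, walkEdges_cons, hs₁] at h₃
        have hsub : walkEdges nxt (v₁.foldl nxt x) s₁ ⊆ walkEdges nxt x v₁ := by
          rintro ⟨y, g⟩ hg
          have hgv : (y, g) ∈ walkEdges nxt x v := h₃ ▸ Or.inr (Or.inl hg)
          obtain ⟨c, d, hcd, hc⟩ := hg
          simp only at hcd hc
          have hd₁ : d.foldl nxt (nxt y g) = v₁.foldl nxt x := by
            conv_rhs => rw [← hs₁, hcd]
            simp [hc]
          have hd₂ : walkEdges nxt (nxt y g) d ⊆ walkEdges nxt x v := by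
            rw [← h₃]
            conv_rhs => rw [hcd, walkEdges_append nxt _ c, walkEdges_cons, hc]
            exact fun y hy => Or.inr (Or.inl (Or.inr (Or.inr hy)))
          have hg₂ := hgv
          rw [hv'] at hg₂
          rcases hg₂ with hg₂ | hg₂ | hg₂
          · exact hg₂
          · obtain ⟨rfl, rfl⟩ := Prod.mk.inj hg₂
            exact absurd ⟨d, hd₁, hd₂⟩ hret
          · obtain ⟨a, b, hab, ha⟩ := hg₂
            simp only at hab ha
            refine absurd ⟨a ++ g :: d, by simp [ha, hd₁], ?_⟩ hret
            rw [walkEdges_append, walkEdges_cons, ha]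
            refine Set.union_subset ?_ (Set.insert_subset hgv hd₂)
            rw [hv', hab, walkEdges_append]
            exact fun y hy => Or.inr (Or.inr (Or.inl hy))
        have hB := h.foldl_loop_of_subset hq v₁ s₁ hs₁ hsub
        refine ⟨s₂, ?_, ?_, ?_⟩
        · rw [← h₁, hs]
          simp [hs₁]
        · rw [← h₂, hs]
          simp [hB]
        · rw [← h₃, List.append_assoc, List.singleton_append, walkEdges_append, walkEdges_cons]
          rw [← Set.union_assoc, Set.union_eq_self_of_subset_right hsub]

end LoopsActAsSemilattice

/-! ### Powers and factors of words -/

/-- The `n`-th power of a word. -/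
def wordPow {α : Type*} (w : List α) (n : ℕ) : List α := (List.replicate n w).flatten

section Words

variable {α : Type*}

lemma wordPow_zero (w : List α) : wordPow w 0 = [] := rfl

lemma wordPow_succ (w : List α) (n : ℕ) : wordPow w (n + 1) = w ++ wordPow w n := by
  simp [wordPow, List.replicate_succ]

lemma wordPow_add (w : List α) (m n : ℕ) : wordPow w (m + n) = wordPow w m ++ wordPow w n := by
  rw [wordPow, List.replicate_add, List.flatten_append, wordPow, wordPow]

lemma wordPow_succ' (w : List α) (n : ℕ) : wordPow w (n + 1) = wordPow w n ++ w := by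
  rw [wordPow_add]
  simp [wordPow]

lemma length_wordPow (w : List α) (n : ℕ) : (wordPow w n).length = n * w.length := by
  simp [wordPow]

lemma le_length_wordPow {w : List α} (hw : w ≠ []) (n : ℕ) : n ≤ (wordPow w n).length := by
  rw [length_wordPow]
  exact Nat.le_mul_of_pos_right _ (List.length_pos_iff.2 hw)

/-- If `x w = w' x`, then `x wⁿ = w'ⁿ x`. -/
lemma append_wordPow_comm {x w w' : List α} (h : x ++ w = w' ++ x) (n : ℕ) :
    x ++ wordPow w n = wordPow w' n ++ x := by
  induction n with
  | zero => simp [wordPow_zero]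
  | succ n ih =>
    rw [wordPow_succ', ← List.append_assoc, ih, List.append_assoc, h, ← List.append_assoc,
      ← wordPow_succ']

/-- The factors of length `m` of a word. -/
def wordFactors (m : ℕ) (u : List α) : Set (List α) := {f | f.length = m ∧ f <:+: u}

lemma wordFactors_mono {m : ℕ} {u v : List α} (h : u <:+: v) :
    wordFactors m u ⊆ wordFactors m v := fun _ hf => ⟨hf.1, hf.2.trans h⟩

/-- A factor of length `m` is too short to extend beyond both ends of `e`. -/
lemma wordFactors_overlap {m : ℕ} {e : List α} (he : m ≤ e.length) (s t : List α) :
    wordFactors m (s ++ e ++ t) = wordFactors m (s ++ e) ∪ wordFactors m (e ++ t) := by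
  apply Set.Subset.antisymm
  · rintro f ⟨hm, p, r, h⟩
    by_cases hl : (p ++ f).length ≤ (s ++ e).length
    · left
      have h₁ : p ++ f <+: s ++ e ++ t := ⟨r, h⟩
      obtain ⟨c, hc⟩ := List.prefix_of_prefix_length_le h₁ (List.prefix_append _ _) hl
      exact ⟨hm, p, c, hc⟩
    · right
      have h₁ : f ++ r <:+ s ++ e ++ t := ⟨p, by rw [← h]; simp⟩
      have h₂ : e ++ t <:+ s ++ e ++ t := ⟨s, by simp⟩
      have hlen := congrArg List.length h
      simp only [List.length_append] at hl hlen
      obtain ⟨c, hc⟩ := List.suffix_of_suffix_length_le h₁ h₂ (by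
        simp only [List.length_append]; omega)
      exact ⟨hm, c, r, by rw [← hc]; simp⟩
  · exact Set.union_subset (wordFactors_mono (List.prefix_append _ _).isInfix)
      (wordFactors_mono ⟨s, [], by simp⟩)

lemma sameProfile_of_wordFactors_eq {m : ℕ} {e : List α} (he : m ≤ e.length) {a b : List α}
    (h : wordFactors m (e ++ a ++ e) = wordFactors m (e ++ b ++ e)) (x w : List α) :
    SameProfile m (x ++ (e ++ a ++ e) ++ w) (x ++ (e ++ b ++ e) ++ w) := by
  refine ⟨?_, ?_, ?_⟩
  · have : ∀ c, (x ++ (e ++ c ++ e) ++ w).take (m - 1) = (x ++ e).take (m - 1) := by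
      intro c
      rw [show x ++ (e ++ c ++ e) ++ w = (x ++ e) ++ (c ++ e ++ w) by simp,
        List.take_append_of_le_length (by simp; omega)]
    rw [this, this]
  · have : ∀ c, (x ++ (e ++ c ++ e) ++ w).drop ((x ++ (e ++ c ++ e) ++ w).length - (m - 1)) =
        (e ++ w).drop ((e ++ w).length - (m - 1)) := by
      intro c
      rw [show x ++ (e ++ c ++ e) ++ w = (x ++ e ++ c) ++ (e ++ w) by simp,
        List.drop_append, List.drop_eq_nil_of_le (by simp; omega), List.nil_append]
      congr 1
      simp
      omega
    rw [this, this]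
  · have : ∀ c, wordFactors m (x ++ (e ++ c ++ e) ++ w) =
        wordFactors m (x ++ e) ∪ (wordFactors m (e ++ c ++ e) ∪ wordFactors m (e ++ w)) := by
      intro c
      rw [show x ++ (e ++ c ++ e) ++ w = x ++ e ++ (c ++ e ++ w) by simp,
        wordFactors_overlap he, show e ++ (c ++ e ++ w) = e ++ c ++ e ++ w by simp,
        wordFactors_overlap he]
    exact (this a).trans ((h ▸ rfl : _ = _).trans (this b).symm)

end Words

lemma Digraph.HasSimplePath.of_le {V : Type*} {G : Digraph V} {m n : ℕ} (h : G.HasSimplePath n)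
    (hmn : m ≤ n) : G.HasSimplePath m := by
  obtain ⟨x, hx, hadj⟩ := h
  exact ⟨fun i => x (i.castLE (by omega)), fun i j hij => by
    simpa [Fin.ext_iff] using hx hij, fun i => hadj (i.castLE hmn)⟩

/-! ### Action of words on a reduced locally testable automaton -/

namespace PartialDFA

variable {α σ : Type*} (A : PartialDFA α σ)

/-- The transition function, made total by the additional sink `none`. -/
def next (s : Option σ) (a : α) : Option σ := s.bind fun p => A.step p a

/-- The action of the words on the states and the additional sink `none`. -/
def act (s : Option σ) (w : List α) : Option σ := w.foldl A.next s

@[simp] lemma act_nil (s : Option σ) : A.act s [] = s := rfl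

@[simp] lemma act_cons (s : Option σ) (a : α) (w : List α) :
    A.act s (a :: w) = A.act (A.next s a) w := rfl

@[simp] lemma act_append (s : Option σ) (u v : List α) :
    A.act s (u ++ v) = A.act (A.act s u) v := List.foldl_append

@[simp] lemma act_none (w : List α) : A.act none w = none := by
  induction w with
  | nil => rfl
  | cons a w ih => exact ih

lemma run_eq_act (p : σ) (w : List α) : A.run p w = A.act (some p) w := by
  induction w generalizing p with
  | nil => rfl
  | cons a w ih =>
    rw [act_cons]
    change (A.step p a).bind _ = A.act (A.step p a) w
    cases A.step p a with
    | none => simp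
    | some q => exact ih q

lemma act_none_exists {s : Option σ} {w : List α} (hs : s ≠ none) (h : A.act s w = none) :
    ∃ p a, A.step p a = none := by
  induction w generalizing s with
  | nil => exact absurd h hs
  | cons a w ih =>
    obtain ⟨p, rfl⟩ := Option.ne_none_iff_exists'.1 hs
    by_cases hp : A.step p a = none
    · exact ⟨p, a, hp⟩
    · exact ih (s := A.next (some p) a) hp h

variable {A}

/-- Words with the same membership in all contexts act in the same way on a reduced automaton. -/
lemma IsReduced.act_eq (hred : A.IsReduced) {u v : List α}
    (h : ∀ x w, x ++ u ++ w ∈ A.accepts ↔ x ++ v ++ w ∈ A.accepts) (s : Option σ) :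
    A.act s u = A.act s v := by
  have mem : ∀ w, w ∈ A.accepts ↔ ∃ q ∈ A.accept, A.act (some A.start) w = some q := by
    intro w
    simp only [← run_eq_act]
    rfl
  cases s with
  | none => simp
  | some p =>
    obtain ⟨x, hx⟩ := hred.reachable p
    rw [run_eq_act] at hx
    have key : ∀ w, (∃ q ∈ A.accept, A.act (A.act (some p) u) w = some q) ↔
        ∃ q ∈ A.accept, A.act (A.act (some p) v) w = some q := by
      intro w
      have := h x w
      simpa only [mem, act_append, hx] using this
    -- If only one of the two words is defined at `p`, some transition is missing, so `alive`
    -- provides a word accepted from the other image.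
    have main : ∀ u v : List α, (∀ w, (∃ q ∈ A.accept, A.act (A.act (some p) u) w = some q) ↔
        ∃ q ∈ A.accept, A.act (A.act (some p) v) w = some q) →
        A.act (some p) u = none → A.act (some p) v = none := by
      intro u v key hu
      by_contra hv
      obtain ⟨q, hq⟩ := Option.ne_none_iff_exists'.1 hv
      obtain ⟨w, r, hr, hw⟩ := hred.alive (A.act_none_exists (by simp) hu) q
      rw [run_eq_act, ← hq] at hw
      obtain ⟨r', -, h'⟩ := (key w).2 ⟨r, hr, hw⟩
      simp [hu] at h'
    rcases hu : A.act (some p) u with _ | a <;> rcases hv : A.act (some p) v with _ | b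
    · rfl
    · rw [main u v key hu] at hv
      cases hv
    · rw [main v u (fun w => (key w).symm) hv] at hu
      cases hu
    · congr 1
      apply hred.distinguishable
      ext w
      have := key w
      rw [hu, hv, ← run_eq_act, ← run_eq_act] at this
      exact this

/-- Replacing the factor between two long equal factors does not change the action of a word, as
long as the factors of some fixed length remain the same. -/
def FactorsDetermineAction (A : PartialDFA α σ) (m : ℕ) : Prop :=
  ∀ e : List α, m ≤ e.length → ∀ a b, wordFactors m (e ++ a ++ e) = wordFactors m (e ++ b ++ e) →
    ∀ s, A.act s (e ++ a ++ e) = A.act s (e ++ b ++ e)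

/-- The outer copies of `e` fix the profile's dependence on the context, so the two words are
interchangeable in every context. -/
lemma IsReduced.factorsDetermineAction (hred : A.IsReduced) {m : ℕ} (hm : 0 < m)
    (h : A.IsTestable m) : A.FactorsDetermineAction m := by
  intro e he a b hab s
  have hne : e ≠ [] := List.length_pos_iff.1 (by omega)
  exact hred.act_eq (fun x w => h _ _ (by simp [hne]) (by simp [hne])
    (sameProfile_of_wordFactors_eq he hab x w)) s

namespace FactorsDetermineAction

variable {m : ℕ}

lemma idem (h : A.FactorsDetermineAction m) {e : List α} (he : m ≤ e.length) (y : List α)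
    (s : Option σ) : A.act s (e ++ y ++ e ++ y ++ e) = A.act s (e ++ y ++ e) := by
  have := h e he (y ++ e ++ y) y (by
    rw [show e ++ (y ++ e ++ y) ++ e = e ++ y ++ e ++ (y ++ e) by simp, wordFactors_overlap he,
      ← List.append_assoc, Set.union_self]) s
  simpa using this

lemma comm (h : A.FactorsDetermineAction m) {e : List α} (he : m ≤ e.length) (y z : List α)
    (s : Option σ) : A.act s (e ++ y ++ e ++ z ++ e) = A.act s (e ++ z ++ e ++ y ++ e) := by
  have key : ∀ y z, wordFactors m (e ++ (y ++ e ++ z) ++ e) =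
      wordFactors m (e ++ y ++ e) ∪ wordFactors m (e ++ z ++ e) := by
    intro y z
    rw [show e ++ (y ++ e ++ z) ++ e = e ++ y ++ e ++ (z ++ e) by simp, wordFactors_overlap he,
      ← List.append_assoc]
  have := h e he (y ++ e ++ z) (z ++ e ++ y) (by rw [key, key, Set.union_comm]) s
  simpa using this

lemma pow_stable (h : A.FactorsDetermineAction m) (w : List α) :
    ∃ N, ∀ n, N ≤ n → ∀ s, A.act s (wordPow w (n + 1)) = A.act s (wordPow w n) := by
  by_cases hw : w = []
  · exact ⟨0, fun n _ s => by simp [hw, wordPow]⟩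
  -- With `e = w ^ (m + 1)`, the words `e w e` and `e e` have the same factors of length `m`.
  have base : ∀ s, A.act s (wordPow w (2 * (m + 1) + 1)) = A.act s (wordPow w (2 * (m + 1))) := by
    intro s
    set e := wordPow w (m + 1) with he'
    have he : m ≤ e.length := (Nat.le_succ m).trans (le_length_wordPow hw _)
    have h₁ : wordPow w (2 * (m + 1) + 1) = e ++ w ++ e := by
      rw [show 2 * (m + 1) + 1 = (m + 1) + 1 + (m + 1) by ring, wordPow_add, wordPow_succ']
    have h₂ : wordPow w (2 * (m + 1)) = e ++ [] ++ e := by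
      rw [two_mul, wordPow_add, List.append_nil]
    rw [h₁, h₂]
    refine h e he w [] ?_ s
    have h₃ : w ++ e = e ++ w := by rw [he', ← wordPow_succ, wordPow_succ']
    have h₄ : e = wordPow w m ++ w := by rw [he', wordPow_succ']
    rw [List.append_nil, ← h₃, wordFactors_overlap he]
    apply Set.union_eq_self_of_subset_left
    apply wordFactors_mono
    exact ⟨wordPow w m, [], by
      conv_rhs => rw [h₄]
      simp [h₄]⟩
  refine ⟨2 * (m + 1), fun n hn s => ?_⟩
  obtain ⟨d, rfl⟩ := Nat.exists_eq_add_of_le' hn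
  rw [add_assoc, wordPow_add, wordPow_add w d, act_append, act_append, base]

end FactorsDetermineAction

variable (A) in
/-- Reachability among the states and the additional sink. -/
def Reaches (s t : Option σ) : Prop := ∃ w, A.act s w = t

lemma Reaches.refl (s : Option σ) : A.Reaches s s := ⟨[], rfl⟩

lemma Reaches.trans {s t u : Option σ} (h₁ : A.Reaches s t) (h₂ : A.Reaches t u) :
    A.Reaches s u := by
  obtain ⟨v, rfl⟩ := h₁
  obtain ⟨w, rfl⟩ := h₂
  exact ⟨v ++ w, by simp⟩

lemma reaches_act (s : Option σ) (w : List α) : A.Reaches s (A.act s w) := ⟨w, rfl⟩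

lemma Reaches.ne_none {s t : Option σ} (h : A.Reaches s t) (ht : t ≠ none) : s ≠ none := by
  rintro rfl
  obtain ⟨w, rfl⟩ := h
  simp at ht

lemma act_wordPow_of_act_eq {s : Option σ} {w : List α} (h : A.act s w = s) (n : ℕ) :
    A.act s (wordPow w n) = s := by
  induction n with
  | zero => rfl
  | succ n ih => rw [wordPow_succ, act_append, h, ih]

namespace FactorsDetermineAction

variable {m : ℕ}

/-- With `q = p y`, `p = q z` and `E` a long power of `e`, commutation gives `p = p z E y E`;
idempotence then makes a further `y E` act trivially on `p`, although it leads to `q`. -/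
lemma eq_of_reaches (h : A.FactorsDetermineAction m) {e : List α} (he : e ≠ []) {p q : Option σ}
    (hp : A.act p e = p) (hq : A.act q e = q) (hpq : A.Reaches p q) (hqp : A.Reaches q p) :
    p = q := by
  obtain ⟨y, rfl⟩ := hpq
  obtain ⟨z, hz⟩ := hqp
  have hE := act_wordPow_of_act_eq hp m
  have hE' := act_wordPow_of_act_eq hq m
  have hlen := le_length_wordPow he m
  generalize wordPow e m = E at *
  have hc := h.comm hlen y z p
  have hi := h.idem hlen y (A.act p z)
  simp only [act_append, hE, hE', hz] at hc hi
  have hq' : A.act p (z ++ E ++ y ++ E) = p := by simpa using hc.symm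
  simp only [act_append] at hq'
  rw [hq', hE'] at hi
  exact hi.symm

/-- From `f` to `F` one uses idempotence of the path `f u r = F`; from `F` to `f`, its commutation
with the path from `f` to `F`. -/
lemma reaches_iff (h : A.FactorsDetermineAction m) {e : List α} (he : e ≠ []) {f F : Option σ}
    (hf : A.act f e = f) (hF : A.act F e = F) (hfF : A.Reaches f F) (u : List α) :
    A.Reaches (A.act f u) F ↔ A.Reaches (A.act F u) F := by
  have hlen := le_length_wordPow he m
  have hE := act_wordPow_of_act_eq hf m
  have hE' := act_wordPow_of_act_eq hF m
  generalize wordPow e m = E at *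
  obtain ⟨w, rfl⟩ := hfF
  constructor
  · rintro ⟨r, hr⟩
    refine ⟨r ++ E, ?_⟩
    have := h.idem hlen (u ++ r) f
    simp only [act_append, hE, hE', hr] at this ⊢
    exact this
  · rintro ⟨r, hr⟩
    refine ⟨r ++ E ++ w ++ E, ?_⟩
    have := h.comm hlen w (u ++ r) f
    simp only [act_append, hE, hE', hr] at this ⊢
    exact this.symm

end FactorsDetermineAction

end PartialDFA

/-! ### Simple paths and cycles in the 2-tuple graph -/

namespace PartialDFA

variable {α σ : Type*} (A : PartialDFA α σ)

/-- The nodes of the 2-tuple graph, as pairs of elements of `Option σ`. -/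
def IsNode (x : Option σ × Option σ) : Prop := x.2 ≠ none ∧ A.Reaches x.1 x.2 ∧ x.1 ≠ x.2

/-- The edges of the 2-tuple graph, as a relation on pairs of elements of `Option σ`. -/
def IsEdge (x y : Option σ × Option σ) : Prop :=
  ∃ a, A.next x.1 a = y.1 ∧ A.next x.2 a = y.2

variable {A}

lemma hasSimplePath_of_injOn {n : ℕ} (π : ℕ → Option σ × Option σ)
    (hnode : ∀ t ≤ n, A.IsNode (π t)) (hedge : ∀ t < n, A.IsEdge (π t) (π (t + 1)))
    (hinj : Set.InjOn π (Set.Iic n)) : A.twoTupleGraph.HasSimplePath n := by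
  have key : ∀ t : ℕ, t ≤ n → ∃ x : {x : σ × σ // A.Above x.1 x.2},
      π t = (some x.1.1, some x.1.2) := by
    intro t ht
    obtain ⟨h₁, h₂, h₃⟩ := hnode t ht
    obtain ⟨q, hq⟩ := Option.ne_none_iff_exists'.1 h₁
    obtain ⟨p, hp⟩ := Option.ne_none_iff_exists'.1 (h₂.ne_none h₁)
    rw [hp, hq] at h₂ h₃
    obtain ⟨w, hw⟩ := h₂
    exact ⟨⟨(p, q), ⟨w, by rw [run_eq_act, hw]⟩, fun h => h₃ (congrArg some h)⟩,
      Prod.ext hp hq⟩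
  have : Nonempty {x : σ × σ // A.Above x.1 x.2} := ⟨(key 0 (Nat.zero_le _)).choose⟩
  choose! x hx using key
  refine ⟨fun i => x i, fun i j hij => ?_, fun i => ?_⟩
  · have hi := hx i (Nat.lt_succ_iff.1 i.2)
    have hj := hx j (Nat.lt_succ_iff.1 j.2)
    simp only at hij
    rw [hij, ← hj] at hi
    exact Fin.ext (hinj (Nat.lt_succ_iff.1 i.2) (Nat.lt_succ_iff.1 j.2) hi)
  · obtain ⟨a, h₁, h₂⟩ := hedge i i.2
    rw [hx i i.2.le, hx (i + 1) i.2] at h₁ h₂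
    exact ⟨a, h₁, h₂⟩

/-- A walk in the 2-tuple graph all of whose repetitions occur between the times `n` and `t₁`
contains a simple path that is at least as long as the two remaining parts together. -/
lemma hasSimplePath_of_walk (n T t₁ : ℕ) (π : ℕ → Option σ × Option σ) (hn : n ≤ t₁)
    (ht₁ : t₁ ≤ T) (hnode : ∀ t ≤ T, A.IsNode (π t))
    (hedge : ∀ t < T, A.IsEdge (π t) (π (t + 1)))
    (hrep : ∀ i j, i < j → j ≤ T → π i = π j → n ≤ i ∧ j < t₁) {k : ℕ}
    (hk : k ≤ n + (T - t₁)) : A.twoTupleGraph.HasSimplePath k := by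
  induction T using Nat.strong_induction_on generalizing t₁ π with
  | _ T ih =>
    by_cases hinj : Set.InjOn π (Set.Iic T)
    · exact (hasSimplePath_of_injOn π hnode hedge hinj).of_le (by omega)
    · obtain ⟨i, j, hij, hj, heq⟩ : ∃ i j, i < j ∧ j ≤ T ∧ π i = π j := by
        simp only [Set.InjOn, Set.mem_Iic] at hinj
        push Not at hinj
        obtain ⟨i, hi, j, hj, heq, hne⟩ := hinj
        rcases lt_or_gt_of_ne hne with h | h
        · exact ⟨i, j, h, hj, heq⟩
        · exact ⟨j, i, h, hi, heq.symm⟩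
      obtain ⟨h₁, h₂⟩ := hrep i j hij hj heq
      -- Cutting out the closed part from `i` to `j` lowers `T` and `t₁` alike, so `n + (T - t₁)` is
      -- unchanged.
      refine ih (T - (j - i)) (by omega) (t₁ - (j - i))
        (fun t => if t ≤ i then π t else π (t + (j - i))) (by omega) (by omega) ?_ ?_ ?_ (by omega)
      · intro t ht
        split_ifs
        · exact hnode t (by omega)
        · exact hnode _ (by omega)
      · intro t ht
        split_ifs with h₃ h₄ h₄
        · exact hedge t (by omega)
        · obtain rfl : t = i := by omega
          rw [heq, show t + 1 + (j - t) = j + 1 by omega]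
          exact hedge j (by omega)
        · omega
        · rw [show t + 1 + (j - i) = t + (j - i) + 1 by omega]
          exact hedge _ (by omega)
      · intro i' j' hij' hj' heq'
        split_ifs at heq' with h₃ h₄ h₄
        · have := hrep _ _ hij' (by omega) heq'
          omega
        · have := hrep _ _ (by omega) (by omega) heq'
          omega
        · omega
        · have := hrep _ _ (by omega) (by omega) heq'
          omega

lemma act_take_succ (s : Option σ) {x : List α} {t : ℕ} (ht : t < x.length) :
    A.act s (x.take (t + 1)) = A.next (A.act s (x.take t)) x[t] := by
  rw [List.take_succ_eq_append_getElem ht, act_append]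
  rfl

/-- Reading a word without leaving the nodes of the 2-tuple graph either gives a simple path or
runs through a cycle. -/
lemma exists_cycle {x : List α} (hpath : ¬ A.twoTupleGraph.HasSimplePath x.length)
    {s t : Option σ}
    (hnode : ∀ x₁ x₂, x = x₁ ++ x₂ → A.IsNode (A.act s x₁, A.act t x₁)) :
    ∃ x₁ x₂ x₃, x = x₁ ++ x₂ ++ x₃ ∧ x₂ ≠ [] ∧
      A.act (A.act s x₁) x₂ = A.act s x₁ ∧ A.act (A.act t x₁) x₂ = A.act t x₁ := by
  by_contra hcon
  push Not at hcon
  refine hpath (hasSimplePath_of_walk 0 x.length 0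
    (fun i => (A.act s (x.take i), A.act t (x.take i))) le_rfl (Nat.zero_le _) ?_ ?_ ?_ (by simp))
  · intro i _
    exact hnode _ _ (List.take_append_drop i x).symm
  · intro i hi
    exact ⟨x[i], (act_take_succ s hi).symm, (act_take_succ t hi).symm⟩
  · intro i j hij hj heq
    obtain ⟨h₁, h₂⟩ := Prod.mk.inj heq
    have hx : x.take j = x.take i ++ (x.drop i).take (j - i) := by
      rw [← List.take_add]
      congr 1
      omega
    refine absurd ?_ (hcon (x.take i) ((x.drop i).take (j - i)) (x.drop j)
      (by rw [← hx, List.take_append_drop]) ?_ ?_)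
    · rw [← act_append, ← hx, h₂]
    · apply List.ne_nil_of_length_pos
      simp
      omega
    · rw [← act_append, ← hx, h₁]

/-- Inside a strongly connected component, long words act as constants. -/
lemma act_eq_of_reaches {m : ℕ} (h : A.FactorsDetermineAction m) {x : List α}
    (hpath : ¬ A.twoTupleGraph.HasSimplePath x.length) {s t : Option σ}
    (hst : A.Reaches s t) (hts : A.Reaches t s) (hs : A.Reaches (A.act s x) s)
    (ht : A.Reaches (A.act t x) t) : A.act s x = A.act t x := by
  by_contra hne
  have htn : t ≠ none := by
    rintro rfl
    obtain ⟨w, rfl⟩ := hts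
    simp at hne
  have hmid : ∀ s x₁ x₂, x = x₁ ++ x₂ → A.Reaches (A.act s x) s → A.Reaches (A.act s x₁) s := by
    rintro s x₁ x₂ hx hs
    rw [hx, act_append] at hs
    exact (reaches_act _ _).trans hs
  obtain ⟨x₁, x₂, x₃, hx, hx₂, h₁, h₂⟩ := exists_cycle hpath (s := s) (t := t) (by
    rintro x₁ x₂ hx
    refine ⟨(hmid t x₁ x₂ hx ht).ne_none htn,
      (hmid s x₁ x₂ hx hs).trans (hst.trans (reaches_act _ _)), fun heq => hne ?_⟩
    rw [hx, act_append, act_append]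
    exact congrArg (fun r => A.act r x₂) heq)
  rw [List.append_assoc] at hx
  have := h.eq_of_reaches hx₂ h₁ h₂ ((hmid s _ _ hx hs).trans (hst.trans (reaches_act _ _)))
    ((hmid t _ _ hx ht).trans (hts.trans (reaches_act _ _)))
  apply hne
  rw [hx, act_append, this, ← act_append]

end PartialDFA

/-! ### Solutions of `x w = w' x` -/

section Words

variable {α : Type*} {x w w' : List α}

lemma exists_append_eq_of_prefix (h : x ++ w = w' ++ x) {x₁ : List α} (hx : x₁ <+: x) :
    ∃ v, w' ++ x₁ = x₁ ++ v := by
  have h₁ : x₁ <+: w' ++ x := h ▸ hx.trans (List.prefix_append _ _)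
  obtain ⟨v, hv⟩ := List.prefix_of_prefix_length_le h₁ ((List.prefix_append_right_inj w').2 hx)
    (by simp)
  exact ⟨v, hv.symm⟩

lemma prefix_wordPow (h : x ++ w = w' ++ x) (hw : w' ≠ []) {n : ℕ} (hn : x.length ≤ n) :
    x <+: wordPow w' n := by
  refine List.prefix_of_prefix_length_le (l₃ := wordPow w' n ++ x) ?_ (List.prefix_append _ _)
    (hn.trans (le_length_wordPow hw n))
  rw [← append_wordPow_comm h]
  exact List.prefix_append _ _

lemma length_eq_of_append_comm (h : x ++ w = w' ++ x) : w'.length = w.length := by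
  have := congrArg List.length h
  simp only [List.length_append] at this
  omega

lemma getElem?_eq_of_append_comm (h : x ++ w = w' ++ x) (hw : w' ≠ []) (t : ℕ)
    (ht : t < x.length) : x[t]? = w'[t % w'.length]? := by
  have hpos : 0 < w'.length := List.length_pos_iff.2 hw
  induction t using Nat.strong_induction_on with
  | _ t ih =>
    have h₁ : (x ++ w)[t]? = (w' ++ x)[t]? := by rw [h]
    rw [List.getElem?_append_left ht] at h₁
    by_cases hr : t < w'.length
    · rw [h₁, List.getElem?_append_left hr, Nat.mod_eq_of_lt hr]
    · rw [h₁, List.getElem?_append_right (by omega), ih _ (by omega) (by omega),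
        Nat.mod_eq_sub_mod (a := t) (by omega)]

end Words

/-! ### Trajectories under a periodic word -/

namespace PartialDFA

variable {α σ : Type*} {A : PartialDFA α σ} {m : ℕ}

section Trajectory

variable {c : ℕ → α} {a : ℕ → Option σ} {r : ℕ}

lemma act_segment (ha : ∀ t, a (t + 1) = A.next (a t) (c t)) (i l : ℕ) :
    A.act (a i) ((List.range l).map fun t => c (i + t)) = a (i + l) := by
  induction l with
  | zero => rfl
  | succ l ih =>
    rw [List.range_succ, List.map_append, act_append, ih, ← add_assoc, ha]
    rfl

lemma reaches_of_le (ha : ∀ t, a (t + 1) = A.next (a t) (c t)) {i j : ℕ} (hij : i ≤ j) :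
    A.Reaches (a i) (a j) := by
  obtain ⟨l, rfl⟩ := Nat.exists_eq_add_of_le hij
  exact ⟨_, act_segment ha i l⟩

lemma act_segment_add (ha : ∀ t, a (t + 1) = A.next (a t) (c t)) (hc : ∀ t, c (t + r) = c t)
    (i l : ℕ) : A.act (a (i + r)) ((List.range l).map fun t => c (i + t)) = a (i + r + l) := by
  rw [← act_segment ha (i + r) l]
  congr 2
  funext t
  rw [← hc (i + t)]
  congr 1
  ring

/-- The label of the cycle fixes both `a i` and `a (i + r)`, so by `reaches_iff` the question for `a
(i + r + n)` is equivalent to that for `a (i + n)`, one period earlier. -/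
lemma reaches_of_cycle (h : A.FactorsDetermineAction m)
    (ha : ∀ t, a (t + 1) = A.next (a t) (c t)) (hr : 0 < r) (hc : ∀ t, c (t + r) = c t)
    {i j : ℕ} (hij : i < j) (h₁ : a j = a i) (h₂ : a (j + r) = a (i + r)) (n : ℕ) :
    A.Reaches (a (i + r + n)) (a (i + r)) := by
  have e₁ := act_segment ha i (j - i)
  have e₂ := act_segment_add ha hc i (j - i)
  rw [show i + (j - i) = j by omega, h₁] at e₁
  rw [show i + r + (j - i) = j + r by omega, h₂] at e₂
  have hne : ((List.range (j - i)).map fun t => c (i + t)) ≠ [] :=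
    List.ne_nil_of_length_pos (by simpa using hij)
  induction n using Nat.strong_induction_on with
  | _ n ih =>
    rw [← act_segment_add ha hc i n,
      ← h.reaches_iff hne e₁ e₂ (reaches_of_le ha (Nat.le_add_right i r)), act_segment ha i n]
    by_cases hn : n ≤ r
    · exact reaches_of_le ha (by omega)
    · rw [show i + n = i + r + (n - r) by omega]
      exact ih _ (by omega)

lemma not_reaches_of_cycle (h : A.FactorsDetermineAction m)
    (ha : ∀ t, a (t + 1) = A.next (a t) (c t)) (hc : ∀ t, c (t + r) = c t)
    {i j : ℕ} (hij : i < j) (h₁ : a j = a i) (h₂ : a (j + r) = a (i + r))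
    (hne : a i ≠ a (i + r)) : ¬ A.Reaches (a (i + r)) (a i) := by
  have e₁ := act_segment ha i (j - i)
  have e₂ := act_segment_add ha hc i (j - i)
  rw [show i + (j - i) = j by omega, h₁] at e₁
  rw [show i + r + (j - i) = j + r by omega, h₂] at e₂
  have hnil : ((List.range (j - i)).map fun t => c (i + t)) ≠ [] :=
    List.ne_nil_of_length_pos (by simpa using hij)
  exact fun hr => hne (h.eq_of_reaches hnil e₁ e₂ (reaches_of_le ha (Nat.le_add_right i r)) hr)

/-- A trajectory under a periodic word is periodic from the time bounded by the length of the
simple paths of the 2-tuple graph. -/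
lemma trajectory_eq (h : A.FactorsDetermineAction m)
    (ha : ∀ t, a (t + 1) = A.next (a t) (c t)) (hr : 0 < r) (hc : ∀ t, c (t + r) = c t) {K : ℕ}
    (hpath : ¬ A.twoTupleGraph.HasSimplePath K) : a (K + r + r) = a (K + r) := by
  by_contra hne
  have hmerge : ∀ t d, a t = a (t + r) → a (t + d) = a (t + d + r) := by
    intro t d hd
    induction d with
    | zero => exact hd
    | succ d ih =>
      rw [← add_assoc, ha, ih, show t + d + 1 + r = t + d + r + 1 by ring, ha, hc]
  -- Once equal, the two components stay equal, so they differ up to time `K + r`.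
  have hdist : ∀ t ≤ K + r, a t ≠ a (t + r) := by
    intro t ht heq
    have := hmerge t (K + r - t) heq
    rw [show t + (K + r - t) = K + r by omega] at this
    exact hne this.symm
  have hdef : a (K + r) ≠ none := by
    intro h0
    obtain ⟨w, hw⟩ := reaches_of_le ha (Nat.le_add_right (K + r) r)
    rw [h0, act_none] at hw
    exact hne (hw.symm.trans h0.symm)
  have hedge : ∀ t, A.IsEdge (a t, a (t + r)) (a (t + 1), a (t + 1 + r)) := fun t =>
    ⟨c t, (ha t).symm, by
      change A.next (a (t + r)) (c t) = a (t + 1 + r)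
      rw [add_right_comm, ha, hc]⟩
  obtain ⟨i, j, hij, hj, h₁, h₂⟩ :
      ∃ i j, i < j ∧ j ≤ K ∧ a j = a i ∧ a (j + r) = a (i + r) := by
    by_contra hcon
    push Not at hcon
    refine hpath (hasSimplePath_of_walk 0 K 0 (fun t => (a t, a (t + r))) le_rfl (Nat.zero_le _)
      (fun t ht => ⟨?_, reaches_of_le ha (Nat.le_add_right t r), hdist t (by omega)⟩)
      (fun t _ => hedge t) (fun i j hij hj heq => ?_) (by simp))
    · exact (reaches_of_le ha (by omega : t + r ≤ K + r)).ne_none hdef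
    · obtain ⟨e₁, e₂⟩ := Prod.mk.inj heq
      exact absurd e₂.symm (hcon i j hij hj e₁.symm)
  have hF : ∀ t, A.Reaches (a t) (a (i + r)) := fun t =>
    (reaches_of_le ha (by omega : t ≤ i + r + t)).trans (reaches_of_cycle h ha hr hc hij h₁ h₂ t)
  have hFdef : a (i + r) ≠ none := (reaches_of_le ha (by omega : i + r ≤ K + r)).ne_none hdef
  have hex : ∃ t, A.Reaches (a (i + r)) (a t) := ⟨i + r, Reaches.refl _⟩
  classical
  -- `i₀` is the time at which the trajectory enters the strongly connected component of `a (i +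
  -- r)`, where it stays.
  obtain ⟨i₀, hi₀, hmin⟩ : ∃ i₀, A.Reaches (a (i + r)) (a i₀) ∧
      ∀ t, A.Reaches (a (i + r)) (a t) → i₀ ≤ t :=
    ⟨Nat.find hex, Nat.find_spec hex, fun t ht => Nat.find_min' hex ht⟩
  have hi₀le := hmin _ (Reaches.refl _)
  -- A repeated pair at times `i' < j'` has its second component inside this component and its first
  -- outside, so `i₀ - r ≤ i'` and `j' < i₀`. Removing all repetitions from the walk of length `K +
  -- r` costs at most `r` edges.
  refine hpath (hasSimplePath_of_walk (i₀ - r) (K + r) i₀ (fun t => (a t, a (t + r)))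
    (by omega) (by omega)
    (fun t ht => ⟨(hF _).ne_none hFdef, reaches_of_le ha (Nat.le_add_right t r), hdist t ht⟩)
    (fun t _ => hedge t) (fun i' j' hij' hj' heq => ?_) (by omega))
  obtain ⟨e₁, e₂⟩ := Prod.mk.inj heq
  have hF' := reaches_of_cycle h ha hr hc hij' e₁.symm e₂.symm
  have hn' := not_reaches_of_cycle h ha hc hij' e₁.symm e₂.symm (hdist i' (by omega))
  constructor
  · have := hmin (i' + r) ((reaches_of_le ha (by omega : i + r ≤ i' + r + (i + r))).trans (hF' _))
    omega
  · by_contra hcon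
    refine hn' ((hF _).trans (hi₀.trans ?_))
    rw [e₁]
    exact reaches_of_le ha (by omega)

end Trajectory

/-! ### Loops at a word are commuting idempotents -/

variable {x : List α}

lemma act_loop_idem (h : A.FactorsDetermineAction m)
    (hpath : ¬ A.twoTupleGraph.HasSimplePath x.length) {w w' : List α} (hw : x ++ w = w' ++ x)
    (s : Option σ) : A.act s (x ++ w ++ w) = A.act s (x ++ w) := by
  by_cases hnil : w' = []
  · have := length_eq_of_append_comm hw
    obtain rfl : w = [] := List.length_eq_zero_iff.1 (by simpa [hnil] using this.symm)
    simp
  have hpos : 0 < w'.length := List.length_pos_iff.2 hnil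
  set c : ℕ → α := fun t => w'[t % w'.length]'(Nat.mod_lt _ hpos) with hc
  set a : ℕ → Option σ := fun t => A.act s ((List.range t).map c) with ha
  have hcr : ∀ t, c (t + w'.length) = c t := fun t => by simp [hc]
  have hstep : ∀ t, a (t + 1) = A.next (a t) (c t) := by
    intro t
    simp only [ha, List.range_succ, List.map_append, act_append]
    rfl
  have hw' : (List.range w'.length).map c = w' := by
    apply List.ext_getElem (by simp)
    intro t h₁ h₂
    simp [hc, Nat.mod_eq_of_lt h₂]
  have hx : (List.range x.length).map c = x := by
    apply List.ext_getElem?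
    intro t
    by_cases ht : t < x.length
    · rw [getElem?_eq_of_append_comm hw hnil t ht,
        List.getElem?_eq_getElem (Nat.mod_lt _ hpos)]
      simp [hc, ht]
    · rw [List.getElem?_eq_none (by simpa using ht), List.getElem?_eq_none (by simpa using ht)]
  have hshift : ∀ n, (List.range (n + w'.length)).map c = w' ++ (List.range n).map c := by
    intro n
    rw [add_comm, List.range_add, List.map_append, hw', List.map_map]
    congr 2
    funext t
    simp only [Function.comp]
    rw [add_comm, hcr]
  -- At `K = x.length` the two states of the trajectory are `s w' w' x` and `s w' x`.
  have := trajectory_eq h hstep hpos hcr hpath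
  simp only [ha, hshift, hx] at this
  rw [hw, List.append_assoc, hw]
  exact this

/-- High powers of `w'` lead to a state fixed by `w'`; as `x` is a prefix of a power of `w'`,
reading `x` from there can be completed to a return. -/
lemma reaches_act_wordPow (h : A.FactorsDetermineAction m) {w w' : List α}
    (hw : x ++ w = w' ++ x) (hnil : w' ≠ []) (s : Option σ) :
    ∃ n, A.act (A.act s (wordPow w' (n + 1))) w' = A.act s (wordPow w' (n + 1)) ∧
      A.Reaches (A.act s (wordPow w' (n + 1) ++ x)) (A.act s (wordPow w' (n + 1))) := by
  obtain ⟨N, hN⟩ := h.pow_stable w'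
  have hfix : A.act (A.act s (wordPow w' (N + x.length + 1))) w' =
      A.act s (wordPow w' (N + x.length + 1)) := by
    rw [← act_append, ← wordPow_succ']
    exact hN _ (by omega) s
  refine ⟨N + x.length, hfix, ?_⟩
  obtain ⟨v, hv⟩ := prefix_wordPow hw hnil le_rfl
  refine ⟨v, ?_⟩
  rw [act_append, ← act_append, hv]
  exact act_wordPow_of_act_eq hfix _

/-- Let `G` be the image of `s` under a high power of `u' t'`. Then `G` and `G u'` lie in one
component, to which `G x = s x` and `G u' x = s x u` also belong, so `x` identifies them. -/
lemma act_loop_eq_of_return (h : A.FactorsDetermineAction m)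
    (hpath : ¬ A.twoTupleGraph.HasSimplePath x.length) {u u' t t' : List α}
    (hu : x ++ u = u' ++ x) (ht : x ++ t = t' ++ x) {s : Option σ}
    (hs : A.act s (x ++ u ++ t) = A.act s x) : A.act s (x ++ u) = A.act s x := by
  by_cases hnil : u' ++ t' = []
  · have := length_eq_of_append_comm hu
    obtain rfl : u = [] := List.length_eq_zero_iff.1
      (by simpa [(List.append_eq_nil_iff.1 hnil).1] using this.symm)
    simp
  have hut : x ++ (u ++ t) = (u' ++ t') ++ x := by
    rw [← List.append_assoc, hu, List.append_assoc, ht, List.append_assoc]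
  obtain ⟨n, hfix, hreach⟩ := reaches_act_wordPow h hut hnil s
  have hx : A.act s (wordPow (u' ++ t') (n + 1) ++ x) = A.act s x := by
    rw [← append_wordPow_comm hut, act_append]
    apply act_wordPow_of_act_eq
    rw [← act_append, ← List.append_assoc, hs]
  rw [act_append] at hreach hx
  set G := A.act s (wordPow (u' ++ t') (n + 1))
  have hux : A.act (A.act G u') x = A.act s (x ++ u) := by
    rw [← act_append, ← hu, act_append, hx, act_append]
  have hback : A.Reaches (A.act G u') G := ⟨t', by rw [← act_append, hfix]⟩
  rw [← hux, ← hx]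
  refine (act_eq_of_reaches h hpath (reaches_act G u') hback hreach ?_).symm
  rw [hux]
  refine Reaches.trans ⟨t, ?_⟩ (hreach.trans (reaches_act G u'))
  rw [← act_append, hs, hx]

/-- Idempotence of `z y` gives a return to `s x z y` after `z`, so `z` fixes this state by
`act_loop_eq_of_return`; `y` fixes it by idempotence. -/
lemma act_absorb (h : A.FactorsDetermineAction m)
    (hpath : ¬ A.twoTupleGraph.HasSimplePath x.length) {y y' z z' : List α}
    (hy : x ++ y = y' ++ x) (hz : x ++ z = z' ++ x) (s : Option σ) :
    A.act (A.act s (x ++ z ++ y)) z = A.act s (x ++ z ++ y) ∧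
      A.act (A.act s (x ++ z ++ y)) y = A.act s (x ++ z ++ y) := by
  have hzy : x ++ z ++ y = z' ++ y' ++ x := by
    rw [hz, List.append_assoc, hy, List.append_assoc]
  constructor
  · have h₁ : A.act (A.act s (z' ++ y')) x = A.act s (x ++ z ++ y) := by
      rw [hzy, ← act_append]
    have h₂ : A.act (A.act s (z' ++ y')) (x ++ z ++ y) = A.act (A.act s (z' ++ y')) x := by
      have := act_loop_idem h hpath (w := z ++ y) (by rw [← List.append_assoc, hzy]) s
      rw [List.append_assoc x z y, act_append, h₁, ← act_append, List.append_assoc x z y, this]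
    have := act_loop_eq_of_return h hpath hz hy h₂
    rwa [act_append, h₁] at this
  · have := act_loop_idem h hpath hy (A.act s z')
    have e : A.act (A.act s z') (x ++ y) = A.act s (x ++ z ++ y) := by
      rw [← act_append, ← List.append_assoc, ← hz]
    rwa [act_append, e] at this

/-- Reading `x` from the pair `(s, s w')` keeps the components distinct and hence meets a cycle.
There `reaches_iff` transfers the return after `v` from the lower component to the upper one. -/
lemma reaches_of_loops (h : A.FactorsDetermineAction m)
    (hpath : ¬ A.twoTupleGraph.HasSimplePath x.length) {v v' w w' : List α}
    (hv : x ++ v = v' ++ x) (hw : x ++ w = w' ++ x) {s : Option σ}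
    (hne : A.act s x ≠ A.act s (x ++ w)) (hdef : A.act s (x ++ w) ≠ none)
    (hret : A.Reaches (A.act s (x ++ w)) (A.act s w'))
    (hgv : A.Reaches (A.act (A.act s (x ++ w)) v) (A.act s (x ++ w))) :
    A.Reaches (A.act s v') (A.act s (x ++ w)) := by
  have hx : A.act (A.act s w') x = A.act s (x ++ w) := by rw [hw, act_append]
  obtain ⟨x₁, x₂, x₃, hx₁, hx₂, h₁, h₂⟩ := exists_cycle hpath (s := s) (t := A.act s w') (by
    rintro x₁ x₂ rfl
    refine ⟨Reaches.ne_none (A := A) ⟨x₂, ?_⟩ hdef, ?_, fun heq => hne ?_⟩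
    · rw [← act_append, hx]
    · obtain ⟨u, hu⟩ := exists_append_eq_of_prefix hw (List.prefix_append x₁ x₂)
      exact ⟨u, by rw [← act_append, ← act_append, hu]⟩
    · rw [← hx, act_append, act_append]
      exact congrArg (fun r => A.act r x₂) heq)
  have hpre : x₁ <+: x := ⟨x₂ ++ x₃, by rw [hx₁, List.append_assoc]⟩
  obtain ⟨u, hu⟩ := exists_append_eq_of_prefix hw hpre
  obtain ⟨b, hb⟩ := exists_append_eq_of_prefix hv hpre
  obtain ⟨x', rfl⟩ := hpre
  have hF : A.Reaches (A.act (A.act s w') x₁) (A.act s (x₁ ++ x' ++ w)) :=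
    ⟨x', by rw [← act_append, hx]⟩
  have key := (h.reaches_iff hx₂ h₁ h₂ ⟨u, by rw [← act_append, ← hu, act_append]⟩ b).2 (by
    rw [← act_append, ← hb]
    refine Reaches.trans ⟨x', ?_⟩ (hgv.trans (hret.trans (reaches_act _ _)))
    rw [← act_append, List.append_assoc, ← hv, act_append, hx])
  rw [← act_append, ← hb, act_append] at key
  exact (reaches_act _ _).trans (key.trans hF)

lemma act_loop_comm_of_ne_none (h : A.FactorsDetermineAction m)
    (hpath : ¬ A.twoTupleGraph.HasSimplePath x.length) {y y' z z' : List α}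
    (hy : x ++ y = y' ++ x) (hz : x ++ z = z' ++ x) {s : Option σ}
    (hdef : A.act s (x ++ y ++ z) ≠ none) : A.act s (x ++ z ++ y) = A.act s (x ++ y ++ z) := by
  by_cases hnil : y' = [] ∨ z' = []
  · rcases hnil with hn | hn
    · have := length_eq_of_append_comm hy
      obtain rfl : y = [] := List.length_eq_zero_iff.1 (by simpa [hn] using this.symm)
      simp
    · have := length_eq_of_append_comm hz
      obtain rfl : z = [] := List.length_eq_zero_iff.1 (by simpa [hn] using this.symm)
      simp
  push Not at hnil
  obtain ⟨gz, gy⟩ := act_absorb h hpath hy hz s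
  obtain ⟨hy₁, hz₁⟩ := act_absorb h hpath hz hy s
  have hzy : x ++ (z ++ y) = (z' ++ y') ++ x := by
    rw [← List.append_assoc, hz, List.append_assoc, hy, List.append_assoc]
  have hyz : x ++ (y ++ z) = (y' ++ z') ++ x := by
    rw [← List.append_assoc, hy, List.append_assoc, hz, List.append_assoc]
  obtain ⟨n, -, hG⟩ := reaches_act_wordPow h hzy (by simp [hnil]) s
  obtain ⟨l, -, hH⟩ := reaches_act_wordPow h hyz (by simp [hnil]) s
  have cW := append_wordPow_comm hzy (n + 1)
  have cV := append_wordPow_comm hyz (l + 1)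
  have hg : A.act s (x ++ wordPow (z ++ y) (n + 1)) = A.act s (x ++ z ++ y) := by
    rw [wordPow_succ, ← List.append_assoc, act_append, ← List.append_assoc]
    exact act_wordPow_of_act_eq (by rw [act_append, gz, gy]) n
  have hh : A.act s (x ++ wordPow (y ++ z) (l + 1)) = A.act s (x ++ y ++ z) := by
    rw [wordPow_succ, ← List.append_assoc, act_append, ← List.append_assoc]
    exact act_wordPow_of_act_eq (by rw [act_append, hy₁, hz₁]) l
  have hgV : A.act (A.act s (x ++ z ++ y)) (wordPow (y ++ z) (l + 1)) = A.act s (x ++ z ++ y) :=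
    act_wordPow_of_act_eq (by rw [act_append, gy, gz]) _
  have hhW : A.act (A.act s (x ++ y ++ z)) (wordPow (z ++ y) (n + 1)) = A.act s (x ++ y ++ z) :=
    act_wordPow_of_act_eq (by rw [act_append, hz₁, hy₁]) _
  rw [← cW, hg] at hG
  rw [← cV, hh] at hH
  -- If `s x` is already one of the two products, both loops fix it and there is nothing to prove.
  by_cases hqg : A.act s x = A.act s (x ++ z ++ y)
  · rw [← hqg] at gz gy
    rw [← hqg, act_append, act_append, gy, gz]
  by_cases hqh : A.act s x = A.act s (x ++ y ++ z)
  · rw [← hqh] at hy₁ hz₁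
    rw [← hqh, act_append, act_append, hz₁, hy₁]
  -- Writing `g`, `h` for the two products and `G`, `H` for the states with `G x = g`, `H x = h`,
  -- this closes the circle `G → h → H → g → G`.
  have hGh := reaches_of_loops h hpath cW cV (by rwa [hh]) (by rwa [hh]) (by rwa [hh])
    (by rw [hh, hhW]; exact Reaches.refl _)
  rw [hh] at hGh
  have hHg := reaches_of_loops h hpath cV cW (by rwa [hg])
    (by rw [hg]; exact hG.ne_none (hGh.ne_none hdef)) (by rwa [hg])
    (by rw [hg, hgV]; exact Reaches.refl _)
  rw [hg] at hHg
  have eG : A.act (A.act s (wordPow (z' ++ y') (n + 1))) x = A.act s (x ++ z ++ y) := by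
    rw [← act_append, ← cW, hg]
  have eH : A.act (A.act s (wordPow (y' ++ z') (l + 1))) x = A.act s (x ++ y ++ z) := by
    rw [← act_append, ← cV, hh]
  have := act_eq_of_reaches h hpath (hGh.trans hH) (hHg.trans hG) (by rwa [eG]) (by rwa [eH])
  rwa [eG, eH] at this

lemma act_loop_comm (h : A.FactorsDetermineAction m)
    (hpath : ¬ A.twoTupleGraph.HasSimplePath x.length) {y y' z z' : List α}
    (hy : x ++ y = y' ++ x) (hz : x ++ z = z' ++ x) (s : Option σ) :
    A.act s (x ++ z ++ y) = A.act s (x ++ y ++ z) := by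
  by_cases h₁ : A.act s (x ++ y ++ z) = none
  · by_cases h₂ : A.act s (x ++ z ++ y) = none
    · rw [h₁, h₂]
    · exact (act_loop_comm_of_ne_none h hpath hz hy h₂).symm
  · exact act_loop_comm_of_ne_none h hpath hy hz h₁

/-! ### The graph of words of length `k - 1` -/

/-- The transition from a word of length `k - 1` to the next one when reading a letter. -/
def shiftWindow (x : List α) (a : α) : List α := (x ++ [a]).tail

lemma length_foldl_shiftWindow (x w : List α) :
    (w.foldl shiftWindow x).length = x.length := by
  induction w generalizing x with
  | nil => rfl
  | cons a w ih => simp [ih, shiftWindow]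

lemma foldl_shiftWindow_suffix (x w : List α) : w.foldl shiftWindow x <:+ x ++ w := by
  induction w generalizing x with
  | nil => simp
  | cons a w ih =>
    refine (ih (shiftWindow x a)).trans ?_
    rw [List.append_cons, shiftWindow]
    exact List.suffix_append_self_iff.2 (List.tail_suffix _)

end PartialDFA

namespace PartialDFA

lemma foldl_shiftWindow_eq {α : Type*} {x y w : List α} (hlen : y.length = x.length)
    (h : y <:+ x ++ w) : w.foldl shiftWindow x = y := by
  have h₁ := foldl_shiftWindow_suffix x w
  have h₂ := length_foldl_shiftWindow x w
  exact (List.suffix_of_suffix_length_le h₁ h (by omega)).eq_of_length (by omega)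

lemma mem_walkEdges_shiftWindow {α : Type*} {x u : List α} {e : List α × α} :
    e ∈ walkEdges shiftWindow x u ↔ e.1.length = x.length ∧ e.1 ++ [e.2] <:+: x ++ u := by
  obtain ⟨y, a⟩ := e
  constructor
  · rintro ⟨u₁, u₂, rfl, rfl⟩
    obtain ⟨p, hp⟩ := foldl_shiftWindow_suffix x u₁
    exact ⟨length_foldl_shiftWindow x u₁, p, u₂, by
      rw [← List.append_assoc, hp]
      simp⟩
  · rintro ⟨hlen, p, r, h⟩
    simp only at hlen h
    have h₁ : p ++ y <+: x ++ u := ⟨a :: r, by rw [← h]; simp⟩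
    obtain ⟨u₁, hu₁⟩ := List.prefix_of_prefix_length_le (List.prefix_append x u) h₁
      (by simp [hlen])
    refine ⟨u₁, r, ?_, foldl_shiftWindow_eq hlen ⟨p, hu₁.symm⟩⟩
    rw [← List.append_cancel_left_eq x, ← h, ← List.append_assoc x, hu₁]
    simp

variable {α σ : Type*} {A : PartialDFA α σ} {m : ℕ}

lemma loopsActAsSemilattice (h : A.FactorsDetermineAction m) {n : ℕ}
    (hpath : ¬ A.twoTupleGraph.HasSimplePath n) :
    LoopsActAsSemilattice shiftWindow A.next
      (fun x s => x.length = n ∧ ∃ t, s = A.act t x) where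
  step := by
    rintro x _ a ⟨hx, t, rfl⟩
    refine ⟨(length_foldl_shiftWindow x [a]).trans hx, ?_⟩
    have e : A.next (A.act t x) a = A.act t (x ++ [a]) := by simp
    rw [e, shiftWindow]
    cases hxa : x ++ [a] with
    | nil => simp at hxa
    | cons b y => exact ⟨A.next t b, rfl⟩
  idem := by
    rintro x _ z ⟨rfl, t, rfl⟩ hz
    obtain ⟨z', hz'⟩ := foldl_shiftWindow_suffix x z
    rw [hz] at hz'
    have := act_loop_idem h hpath hz'.symm t
    simp only [act_append] at this
    exact this
  comm := by
    rintro x _ y z ⟨rfl, t, rfl⟩ hy hz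
    obtain ⟨y', hy'⟩ := foldl_shiftWindow_suffix x y
    obtain ⟨z', hz'⟩ := foldl_shiftWindow_suffix x z
    rw [hy] at hy'
    rw [hz] at hz'
    have := act_loop_comm h hpath hz'.symm hy'.symm t
    simp only [act_append] at this
    exact this

/-- A word shorter than `k` has no factor of length `k`, so the other word is short too, and both
equal their prefix of length `k - 1`. -/
lemma eq_of_sameProfile_of_length_lt {α : Type*} {k : ℕ} {u v : List α} (hp : SameProfile k u v)
    (hu : u.length < k) : u = v := by
  have hv : v.length < k := by
    by_contra hv
    have : v.take k ∈ {f : List α | f.length = k ∧ f <:+: v} :=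
      ⟨by simpa using hv, (List.take_prefix k v).isInfix⟩
    rw [← hp.2.2] at this
    have h₁ := this.2.length_le
    rw [this.1] at h₁
    omega
  rw [← List.take_of_length_le (i := k - 1) (l := u) (by omega), hp.1,
    List.take_of_length_le (by omega)]

theorem act_eq_of_sameProfile (h : A.FactorsDetermineAction m) {k : ℕ} (hk : 0 < k)
    (hpath : ¬ A.twoTupleGraph.HasSimplePath (k - 1)) {u v : List α} (hp : SameProfile k u v)
    (s : Option σ) : A.act s u = A.act s v := by
  by_cases hu : u.length < k
  · rw [eq_of_sameProfile_of_length_lt hp hu]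
  by_cases hv : v.length < k
  · rw [eq_of_sameProfile_of_length_lt (u := v) (v := u)
      ⟨hp.1.symm, hp.2.1.symm, hp.2.2.symm⟩ hv]
  obtain ⟨h₁, h₂, h₃⟩ := hp
  set x := u.take (k - 1) with hx
  have hxlen : x.length = k - 1 := by simp [hx]; omega
  have eu : u = x ++ u.drop (k - 1) := (List.take_append_drop _ _).symm
  have ev : v = x ++ v.drop (k - 1) := by rw [h₁, List.take_append_drop]
  have hedges : ∀ w, walkEdges shiftWindow x w =
      {e | e.1.length = k - 1 ∧
        e.1 ++ [e.2] ∈ {f : List α | f.length = k ∧ f <:+: x ++ w}} := by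
    intro w
    ext e
    rw [mem_walkEdges_shiftWindow, hxlen]
    constructor
    · rintro ⟨a, b⟩
      exact ⟨a, by simp [a]; omega, b⟩
    · rintro ⟨a, -, b⟩
      exact ⟨a, b⟩
  have hend : ∀ w, k ≤ (x ++ w).length → w.foldl shiftWindow x =
      (x ++ w).drop ((x ++ w).length - (k - 1)) := fun w hw =>
    foldl_shiftWindow_eq (by rw [List.length_drop, hxlen]; omega) (List.drop_suffix _ _)
  have := (loopsActAsSemilattice h hpath).foldl_eq_of_walkEdges_eq
    (x := x) (q := A.act s x) ⟨hxlen, s, rfl⟩ (u.drop (k - 1)) (v.drop (k - 1))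
    (by rw [hend _ (by rw [← eu]; omega), hend _ (by rw [← ev]; omega), ← eu, ← ev, h₂])
    (by rw [hedges, hedges, ← eu, ← ev, h₃])
  rw [eu, ev, act_append, act_append]
  exact this

end PartialDFA

/-! ### Testability of the transition semigroup -/

lemma SameProfile.map {α β : Type*} {k : ℕ} {u v : List α} (h : SameProfile k u v)
    (f : α → β) : SameProfile k (u.map f) (v.map f) := by
  obtain ⟨h₁, h₂, h₃⟩ := h
  refine ⟨by rw [← List.map_take, h₁, List.map_take], ?_, ?_⟩
  · rw [List.length_map, List.length_map, ← List.map_drop, h₂, List.map_drop]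
  · have key : ∀ w : List α, {l : List β | l.length = k ∧ l <:+: w.map f} =
        List.map f '' {l : List α | l.length = k ∧ l <:+: w} := by
      intro w
      ext l
      constructor
      · rintro ⟨hl, p, r, h⟩
        obtain ⟨a, b, rfl, ha, rfl⟩ := List.map_eq_append_iff.1 h.symm
        obtain ⟨c, d, rfl, rfl, rfl⟩ := List.map_eq_append_iff.1 ha
        exact ⟨d, ⟨by simpa using hl, c, b, rfl⟩, rfl⟩
      · rintro ⟨l, ⟨hl, p, r, rfl⟩, rfl⟩
        exact ⟨by simpa using hl, p.map f, r.map f, by simp⟩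
    rw [key, key, h₃]

lemma FreeSemigroup.letters_mul {α : Type*} (u v : FreeSemigroup α) :
    (u * v).letters = u.letters ++ v.letters := rfl

namespace PartialDFA

variable {α σ : Type*} (A : PartialDFA α σ)

lemma act_eq_bind (s : Option σ) (w : List α) :
    A.act s w = s.bind fun q => A.act (some q) w := by
  cases s <;> simp

/-- The generators of the transition semigroup: the partial transformations induced by letters. -/
def letterTransformation (a : α) : PartialTransformation σ := fun q => A.step q a

/-- The canonical morphism from the free semigroup on the generators of the transition semigroup. -/
def transitionMorphism :
    FreeSemigroup (Set.range A.letterTransformation) →ₙ* A.transitionSemigroup :=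
  FreeSemigroup.lift fun a => ⟨a.1, Subsemigroup.subset_closure a.2⟩

/-- The alphabet consists of transformations because `IsTestableSemigroup` requires it in the
universe of the semigroup. Each generator is read as a chosen letter inducing it, and
`SameProfile.map` carries profiles along this choice. -/
lemma transitionMorphism_apply (u : FreeSemigroup (Set.range A.letterTransformation)) (q : σ) :
    (A.transitionMorphism u).1 q = A.act (some q) (u.letters.map fun a => a.2.choose) := by
  induction u using FreeSemigroup.recOnMul generalizing q with
  | ih1 a => exact (congrFun a.2.choose_spec q).symm
  | ih2 a v ha hv =>
    rw [map_mul, FreeSemigroup.letters_mul, List.map_append, act_append, ← ha, act_eq_bind]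
    change ((A.transitionMorphism _).1 q).bind _ = _
    congr 1
    funext p
    exact hv p

lemma transitionMorphism_surjective : Function.Surjective A.transitionMorphism := by
  rintro ⟨f, hf⟩
  suffices ∃ u, (A.transitionMorphism u).1 = f from this.imp fun u hu => Subtype.ext hu
  induction hf using Subsemigroup.closure_induction with
  | mem f hf => exact ⟨FreeSemigroup.of ⟨f, hf⟩, rfl⟩
  | mul f g _ _ hf hg =>
    obtain ⟨u, rfl⟩ := hf
    obtain ⟨v, rfl⟩ := hg
    exact ⟨u * v, by rw [map_mul]; rfl⟩

variable {A}

lemma isTestable_of_act_eq {k : ℕ}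
    (h : ∀ u v : List α, SameProfile k u v → ∀ s, A.act s u = A.act s v) : A.IsTestable k := by
  intro u v _ _ hp
  change (∃ q ∈ A.accept, A.run A.start u = some q) ↔ ∃ q ∈ A.accept, A.run A.start v = some q
  rw [run_eq_act, run_eq_act, h u v hp]

lemma isTestableSemigroup_of_act_eq {k : ℕ}
    (h : ∀ u v : List α, SameProfile k u v → ∀ s, A.act s u = A.act s v) :
    IsTestableSemigroup k A.transitionSemigroup := by
  refine ⟨_, A.transitionMorphism, A.transitionMorphism_surjective, fun u v hp => ?_⟩
  apply Subtype.ext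
  funext q
  rw [transitionMorphism_apply, transitionMorphism_apply]
  exact h _ _ (hp.map _) _

end PartialDFA

theorem theorem3p9 {α σ : Type*} [Finite σ] (A : PartialDFA α σ)
    (hred : A.IsReduced) (hlt : A.IsLocallyTestable) (k : ℕ) (hk : 0 < k)
    (hpath : ¬ A.twoTupleGraph.HasSimplePath (k - 1)) :
    A.IsTestable k ∧ IsTestableSemigroup k A.transitionSemigroup ∧
      A.testabilityOrder ≤ k := by
  obtain ⟨m, hm, hA⟩ := hlt
  have hact : ∀ u v : List α, SameProfile k u v → ∀ s, A.act s u = A.act s v := fun u v hp =>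
    PartialDFA.act_eq_of_sameProfile (hred.factorsDetermineAction hm hA) hk hpath hp
  have hk' : A.IsTestable k := PartialDFA.isTestable_of_act_eq hact
  exact ⟨hk', PartialDFA.isTestableSemigroup_of_act_eq hact, Nat.sInf_le ⟨hk, hk'⟩⟩
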